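/- Let $E$ be a complex Fréchet space, i.e. a complete metrizable (in particular Hausdorff) locally convex topological vector space over $\mathbb{C}$, and let $E'$ be its topological dual, the space of continuous linear functionals $E\to\mathbb{C}$. Call a sequence $(x'_n)_{n\in\mathbb{N}}$ in $E'$ an Eidelheit sequence if for every sequence $(a_n)_{n\in\mathbb{N}}$ of complex numbers there is $x\in E$ such that $\langle x'_n,x\rangle=a_n$ for all $n\in\mathbb{N}$. Then $E$ is non-normable (its topology is not the topology of any norm on $E$) if and only if $E'$ contains an Eidelheit sequence. -/

import Mathlib

/-- A complex topological vector space is normable if its topology is the one defined by a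
single norm, that is, by a seminorm that vanishes only at `0`. -/
def IsNormable (E : Type*) [AddCommGroup E] [Module ℂ E] [TopologicalSpace E] : Prop :=
  ∃ p : Seminorm ℂ E, (∀ x : E, p x = 0 → x = 0) ∧ WithSeminorms (fun _ : Fin 1 => p)

/-- A sequence of continuous linear maps `T n : E → F n` is an Eidelheit sequence if for every
choice of right-hand sides `y n ∈ F n` the infinite system of equations `T n x = y n` (for all
`n`) has a solution `x ∈ E`. -/
def IsEidelheit {E : Type*} [AddCommGroup E] [Module ℂ E] [TopologicalSpace E]
    {F : ℕ → Type*} [∀ n, AddCommGroup (F n)] [∀ n, Module ℂ (F n)]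
    [∀ n, TopologicalSpace (F n)] (T : ∀ n, E →L[ℂ] F n) : Prop :=
  ∀ y : ∀ n, F n, ∃ x : E, ∀ n, T n x = y n

open Filter Topology

/-! ### Domination by a seminorm, tested on functionals -/

section Functionals

variable {𝕜 E : Type*} [RCLike 𝕜] [AddCommGroup E] [Module 𝕜 E]

/-- A seminorm `q` is dominated by `p` as soon as every linear functional dominated by `q` is
dominated by `p`. -/
theorem Seminorm.exists_le_mul_of_forall_functional (p q : Seminorm 𝕜 E)
    (h : ∀ f : E →ₗ[𝕜] 𝕜, (∃ C, ∀ x, ‖f x‖ ≤ C * q x) → ∃ C, ∀ x, ‖f x‖ ≤ C * p x) :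
    ∃ C, 0 ≤ C ∧ ∀ x, q x ≤ C * p x := by
  let _ : SeminormedAddCommGroup E := q.toSeminormedAddCommGroup
  let _ : NormedSpace 𝕜 E := ⟨fun a x => (map_smul_eq_mul q a x).le⟩
  have hn : ∀ x : E, ‖x‖ = q x := fun _ => rfl
  have hdual : ∀ f : StrongDual 𝕜 E, ∃ C, ∀ x, ‖f x‖ ≤ C * p x := fun f =>
    h f.toLinearMap ⟨‖f‖, fun x => f.le_opNorm x⟩
  -- The dual of `(E, q)` is complete even when `E` is not, so uniform boundedness applies to
  -- evaluations at points of the unit ball of `p`.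
  obtain ⟨C, hC⟩ := banach_steinhaus
    (g := fun x : {x : E // p x ≤ 1} => NormedSpace.inclusionInDoubleDual 𝕜 E x.1) (by
      intro f
      obtain ⟨C, hC⟩ := hdual f
      refine ⟨max C 0, fun x => ?_⟩
      calc ‖f x.1‖ ≤ C * p x.1 := hC _
        _ ≤ max C 0 * p x.1 := by gcongr; exact le_max_left _ _
        _ ≤ max C 0 := mul_le_of_le_one_right (le_max_right _ _) x.2)
  have hball : ∀ x : E, p x ≤ 1 → q x ≤ C := fun x hx => by
    have h1 := (NormedSpace.inclusionInDoubleDualLi (E := E) 𝕜).norm_map x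
    exact (hn x).symm.le.trans (h1.symm.le.trans (hC ⟨x, hx⟩))
  have hC0 : 0 ≤ C := (apply_nonneg q 0).trans (hball 0 (by simp))
  refine ⟨C, hC0, fun x => ?_⟩
  -- Scaling by `r > p x` rather than by `p x` covers the case `p x = 0`.
  have key : ∀ r : ℝ, p x < r → q x ≤ C * r := fun r hr => by
    have hr0 : 0 < r := (apply_nonneg p x).trans_lt hr
    have h2 := hball ((r⁻¹ : 𝕜) • x) (by
      rw [map_smul_eq_mul, norm_inv, RCLike.norm_ofReal, abs_of_pos hr0, inv_mul_le_iff₀ hr0]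
      simpa using hr.le)
    rw [map_smul_eq_mul, norm_inv, RCLike.norm_ofReal, abs_of_pos hr0, inv_mul_le_iff₀ hr0] at h2
    linarith
  refine ge_of_tendsto (x := 𝓝[>] (p x)) (f := fun r => C * r) ?_
    (eventually_nhdsWithin_of_forall key)
  exact ((continuous_const.mul continuous_id).tendsto _).mono_left nhdsWithin_le_nhds

/-- A functional dominated by `p` on the part of a subspace killed by a functional `g` that is
itself dominated by `p` is dominated by `p` on the whole subspace. -/
theorem Seminorm.exists_bound_of_bound_ker (p : Seminorm 𝕜 E) (f g : E →ₗ[𝕜] 𝕜)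
    (K : Submodule 𝕜 E) (hg : ∃ C, ∀ x, ‖g x‖ ≤ C * p x)
    (hf : ∃ C, ∀ x ∈ K, g x = 0 → ‖f x‖ ≤ C * p x) :
    ∃ C, ∀ x ∈ K, ‖f x‖ ≤ C * p x := by
  obtain ⟨D, hD⟩ := hg
  obtain ⟨C, hC⟩ := hf
  by_cases hK : ∀ x ∈ K, g x = 0
  · exact ⟨C, fun x hx => hC x hx (hK x hx)⟩
  push Not at hK
  obtain ⟨v, hv, hgv⟩ := hK
  set u := (g v)⁻¹ • v with hu
  have huK : u ∈ K := K.smul_mem _ hv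
  have hgu : g u = 1 := by simp [hu, hgv]
  refine ⟨|C| * (1 + D * p u) + D * ‖f u‖, fun x hx => ?_⟩
  have h1 := hC (x - g x • u) (K.sub_mem hx (K.smul_mem _ huK)) (by simp [hgu])
  have h2 : p (x - g x • u) ≤ p x + ‖g x‖ * p u := by
    simpa [map_smul_eq_mul] using map_sub_le_add p x (g x • u)
  have h3 : ‖f x‖ ≤ ‖f (x - g x • u)‖ + ‖g x‖ * ‖f u‖ := by
    have := norm_add_le (f (x - g x • u)) (g x • f u)
    rwa [← map_smul, ← map_add, sub_add_cancel, map_smul, norm_smul] at this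
  calc ‖f x‖ ≤ |C| * (p x + ‖g x‖ * p u) + ‖g x‖ * ‖f u‖ := by
        refine h3.trans (add_le_add_left (h1.trans ?_) _)
        exact mul_le_mul (le_abs_self C) h2 (apply_nonneg _ _) (abs_nonneg _)
    _ ≤ |C| * (p x + D * p x * p u) + D * p x * ‖f u‖ := by
        gcongr <;> exact hD x
    _ = _ := by ring

/-- The kernel conditions are dropped one at a time, each on the intersection of the kernels that
remain. -/
theorem Seminorm.exists_bound_of_bound_forall_ker (p : Seminorm 𝕜 E) (f : E →ₗ[𝕜] 𝕜)
    (g : ℕ → E →ₗ[𝕜] 𝕜) (n : ℕ) (hg : ∀ j < n, ∃ C, ∀ x, ‖g j x‖ ≤ C * p x)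
    (hf : ∃ C, ∀ x, (∀ j < n, g j x = 0) → ‖f x‖ ≤ C * p x) :
    ∃ C, ∀ x, ‖f x‖ ≤ C * p x := by
  induction n with
  | zero => simpa using hf
  | succ n ih =>
    refine ih (fun j hj => hg j (by lia)) ?_
    obtain ⟨C, hC⟩ := p.exists_bound_of_bound_ker f (g n)
      (⨅ j, ⨅ (_ : j < n), LinearMap.ker (g j)) (hg n (by lia)) (by
        obtain ⟨C, hC⟩ := hf
        refine ⟨C, fun x hx hgx => hC x fun j hj => ?_⟩
        simp only [Submodule.mem_iInf, LinearMap.mem_ker] at hx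
        rcases Nat.lt_succ_iff_lt_or_eq.mp hj with h | rfl
        · exact hx j h
        · exact hgx)
    exact ⟨C, fun x hx => hC x (by simpa [Submodule.mem_iInf] using hx)⟩

/-- If `f` is not dominated by `p` but the functionals `g j` are, then `f` takes any prescribed
value at common zeros of the `g j` on which `p` is arbitrarily small. -/
theorem Seminorm.exists_small_solution (p : Seminorm 𝕜 E) (f : E →ₗ[𝕜] 𝕜)
    (g : ℕ → E →ₗ[𝕜] 𝕜) (n : ℕ) (hg : ∀ j < n, ∃ C, ∀ x, ‖g j x‖ ≤ C * p x)
    (hf : ¬ ∃ C, ∀ x, ‖f x‖ ≤ C * p x) {ε : ℝ} (hε : 0 < ε) (c : 𝕜) :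
    ∃ e, p e ≤ ε ∧ f e = c ∧ ∀ j < n, g j e = 0 := by
  have h := mt (p.exists_bound_of_bound_forall_ker f g n hg) hf
  push Not at h
  obtain ⟨x, hx, hlt⟩ := h (‖c‖ / ε)
  have hpos : 0 < ‖f x‖ := lt_of_le_of_lt (by positivity) hlt
  have hne : f x ≠ 0 := norm_pos_iff.mp hpos
  refine ⟨(c / f x) • x, ?_, by simp [hne], fun j hj => by simp [hx j hj]⟩
  rw [map_smul_eq_mul, norm_div, div_mul_eq_mul_div, div_le_iff₀ hpos]
  rw [div_mul_eq_mul_div, div_lt_iff₀ hε] at hlt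
  linarith

end Functionals

/-! ### Continuous seminorms and normability -/

section LocallyConvex

variable {E : Type*} [AddCommGroup E] [Module ℂ E] [TopologicalSpace E]
  [LocallyConvexSpace ℝ E]

open scoped ComplexOrder in
theorem locallyConvexSpace_complex [IsTopologicalAddGroup E] : LocallyConvexSpace ℂ E := by
  rw [locallyConvexSpace_iff_exists_convex_subset_zero]
  intro U hU
  obtain ⟨S, hS, hc, hSU⟩ := (locallyConvexSpace_iff_exists_convex_subset_zero ℝ E).1 ‹_› U hU
  -- Nonnegative complex scalars are real, so real convexity suffices.
  refine ⟨S, hS, convex_of_nonneg_surjective_algebraMap (R := ℝ) (A := ℂ) ?_ hc, hSU⟩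
  intro a ha
  exact ⟨a.re, (Complex.le_def.1 ha).1, (Complex.eq_re_of_ofReal_le ha).symm⟩

variable [IsTopologicalAddGroup E] [ContinuousSMul ℂ E]

open scoped ComplexOrder in
theorem exists_continuous_seminorm_ball_subset {U : Set E} (hU : U ∈ 𝓝 0) :
    ∃ p : Seminorm ℂ E, Continuous p ∧ ∀ x, p x < 1 → x ∈ U := by
  have := locallyConvexSpace_complex (E := E)
  have : ContinuousSMul ℝ E := IsScalarTower.continuousSMul ℂ
  obtain ⟨s, hs, hsU⟩ := (nhds_hasBasis_absConvex_open ℂ E).mem_iff.1 hU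
  let t : AbsConvexOpenSets ℂ E := ⟨s, hs⟩
  refine ⟨gaugeSeminormFamily ℂ E t, with_gaugeSeminormFamily.continuous_seminorm t,
    fun x hx => hsU ?_⟩
  exact (gaugeSeminormFamily_ball t).subset ((Seminorm.mem_ball_zero _).2 hx)

open scoped ComplexOrder in
/-- A Hausdorff locally convex space with a continuous seminorm that dominates all continuous
seminorms is normable. -/
theorem isNormable_of_dominating_seminorm [T2Space E] (p : Seminorm ℂ E) (hp : Continuous p)
    (h : ∀ q : Seminorm ℂ E, Continuous q → ∃ C, 0 ≤ C ∧ ∀ x, q x ≤ C * p x) :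
    IsNormable E := by
  refine ⟨p, fun x hx => ?_, ?_⟩
  · by_contra hne
    obtain ⟨q, hq, hqU⟩ := exists_continuous_seminorm_ball_subset (isOpen_ne.mem_nhds (Ne.symm hne))
    obtain ⟨C, -, hC⟩ := h q hq
    exact hqU x (lt_of_le_of_lt (hC x) (by simp [hx])) rfl
  · have := locallyConvexSpace_complex (E := E)
    have : ContinuousSMul ℝ E := IsScalarTower.continuousSMul ℂ
    refine (PolynormableSpace.withSeminorms ℂ E).congr (fun _ => ?_) (fun q => ?_)
    · exact ⟨{⟨p, hp⟩}, 1, by simp⟩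
    · obtain ⟨C, hC0, hC⟩ := h q.1 q.2
      exact ⟨{0}, ⟨C, hC0⟩, fun x => by
        rw [Finset.sup_singleton]
        exact hC x⟩

/-- On a non-normable Hausdorff locally convex space no continuous seminorm dominates all
continuous functionals. -/
theorem exists_functional_not_bounded [T2Space E] (hE : ¬ IsNormable E) (p : Seminorm ℂ E)
    (hp : Continuous p) : ∃ f : StrongDual ℂ E, ¬ ∃ C, ∀ x, ‖f x‖ ≤ C * p x := by
  by_contra! hcon
  refine hE (isNormable_of_dominating_seminorm p hp fun q hq =>
    p.exists_le_mul_of_forall_functional q fun f ⟨C, hC⟩ => ?_)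
  refine hcon ⟨f, ?_⟩
  refine continuous_of_continuousAt_zero f ?_
  have h0 : Tendsto (fun x => C * q x) (𝓝 0) (𝓝 0) := by
    simpa using (hq.const_mul C).tendsto 0
  simpa [ContinuousAt] using squeeze_zero_norm hC h0

/-- On a normable space no sequence of functionals is an Eidelheit sequence. -/
theorem IsNormable.not_isEidelheit {F : Type*} [AddCommGroup F] [Module ℂ F] [TopologicalSpace F]
    (hF : IsNormable F) (x' : ℕ → StrongDual ℂ F) : ¬ IsEidelheit (F := fun _ => ℂ) x' := by
  intro h
  obtain ⟨p, -, hp⟩ := hF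
  have hb : ∀ n, ∃ C : ℝ, 0 ≤ C ∧ ∀ x, ‖x' n x‖ ≤ C * p x := fun n => by
    obtain ⟨s, C, -, hC⟩ := Seminorm.bound_of_continuous hp (x' n).toSeminorm
      (x' n).continuous.norm
    refine ⟨C, C.2, fun x => (hC x).trans ?_⟩
    have : s.sup (fun _ : Fin 1 => p) ≤ p := Finset.sup_le fun _ _ => le_rfl
    exact mul_le_mul_of_nonneg_left (this x) C.2
  choose C hC0 hC using hb
  -- A solution `x` would give `n * (C n + 1) ≤ C n * p x` for all `n`, which fails once `n > p x`.
  obtain ⟨x, hx⟩ := h fun n => ((n * (C n + 1) : ℝ) : ℂ)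
  obtain ⟨n, hn⟩ := exists_nat_gt (p x)
  have h1 := hC n x
  rw [hx n, Complex.norm_real, Real.norm_of_nonneg (by have := hC0 n; positivity)] at h1
  nlinarith [hC0 n, apply_nonneg p x]

end LocallyConvex

/-! ### Construction of an Eidelheit sequence -/

section Frechet

variable {E : Type*} [AddCommGroup E] [Module ℂ E] [UniformSpace E]
    [IsUniformAddGroup E]

/-- In a space whose topology is controlled by an increasing sequence of seminorms `P n`, a series
with `P n (d n) ≤ (1 / 2) ^ n` has Cauchy partial sums. -/
theorem cauchySeq_of_seminorm_step_le (P : ℕ → Seminorm ℂ E) (hP : Monotone P)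
    (hbasis : ∀ U ∈ 𝓝 (0 : E), ∃ k, ∀ x, P k x < 1 → x ∈ U) (s : ℕ → E)
    (hs : ∀ n, P n (s (n + 1) - s n) ≤ (1 / 2) ^ n) : CauchySeq s := by
  -- The right side is the geometric sum of `(1 / 2) ^ i` over `n ≤ i < n + m`.
  have hstep : ∀ k n m, k ≤ n → P k (s (n + m) - s n) ≤ 2 * (1 / 2) ^ n - 2 * (1 / 2) ^ (n + m) := by
    intro k n m hkn
    induction m with
    | zero => simp
    | succ m ih =>
      have h1 : P k (s (n + m + 1) - s (n + m)) ≤ (1 / 2) ^ (n + m) :=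
        (hP (by lia : k ≤ n + m) _).trans (hs _)
      have h2 := map_add_le_add (P k) (s (n + m + 1) - s (n + m)) (s (n + m) - s n)
      rw [sub_add_sub_cancel] at h2
      rw [← add_assoc, pow_succ]
      linarith
  rw [cauchySeq_iff]
  intro V hV
  rw [uniformity_eq_comap_nhds_zero E] at hV
  obtain ⟨U, hU, hUV⟩ := hV
  obtain ⟨k, hk⟩ := hbasis U hU
  refine ⟨k + 2, fun a ha b hb => hUV (hk _ ?_)⟩
  have hpow : (1 / 2 : ℝ) ^ (k + 2) ≤ 1 / 4 := by
    rw [pow_add]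
    have : (1 / 2 : ℝ) ^ k ≤ 1 := pow_le_one₀ (by norm_num) (by norm_num)
    linarith
  have key : ∀ c, k + 2 ≤ c → ∀ d, c ≤ d → P k (s d - s c) < 1 := by
    intro c hc d hcd
    obtain ⟨m, rfl⟩ := Nat.exists_eq_add_of_le hcd
    have h1 := hstep k c m (by lia)
    have h2 : (0 : ℝ) < (1 / 2) ^ (c + m) := by positivity
    have h3 : (1 / 2 : ℝ) ^ c ≤ (1 / 2) ^ (k + 2) :=
      pow_le_pow_of_le_one (by norm_num) (by norm_num) hc
    linarith
  rcases le_total a b with h | h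
  · exact key a ha b h
  · rw [map_sub_rev]
    exact key b hb a h

variable [CompleteSpace E]

/-- Functionals `f n` form an Eidelheit sequence if `f n` is not dominated by `P n` while all
earlier functionals are, for an increasing sequence of seminorms defining the topology. -/
theorem isEidelheit_of_not_bounded (P : ℕ → Seminorm ℂ E) (hP : Monotone P)
    (hbasis : ∀ U ∈ 𝓝 (0 : E), ∃ k, ∀ x, P k x < 1 → x ∈ U) (f : ℕ → StrongDual ℂ E)
    (hlt : ∀ n, ∀ j < n, ∃ C, ∀ x, ‖f j x‖ ≤ C * P n x)
    (hnot : ∀ n, ¬ ∃ C, ∀ x, ‖f n x‖ ≤ C * P n x) :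
    IsEidelheit (F := fun _ => ℂ) f := by
  intro a
  have hsmall : ∀ (n : ℕ) (c : ℂ), ∃ e, P n e ≤ (1 / 2) ^ n ∧ f n e = c ∧ ∀ j < n, f j e = 0 :=
    fun n c => (P n).exists_small_solution (f n).toLinearMap (fun j => (f j).toLinearMap) n
      (hlt n) (hnot n) (by positivity) c
  choose e he hfe hze using hsmall
  -- Step `n` adds the current error of equation `n`, along a vector killed by all `f j` with `j <
  -- n`.
  let s : ℕ → E := Nat.rec 0 fun n t => t + e n (a n - f n t)
  have hs : ∀ n, s (n + 1) = s n + e n (a n - f n (s n)) := fun _ => rfl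
  obtain ⟨x, hx⟩ := cauchySeq_tendsto_of_complete <|
    cauchySeq_of_seminorm_step_le P hP hbasis s fun n => by
      rw [hs, add_sub_cancel_left]
      exact he _ _
  have hval : ∀ k m, f k (s (k + 1 + m)) = a k := by
    intro k m
    induction m with
    | zero => rw [add_zero, hs, map_add, hfe, add_sub_cancel]
    | succ m ih => rw [← add_assoc, hs, map_add, hze _ _ k (by lia), add_zero, ih]
  refine ⟨x, fun k => tendsto_nhds_unique (((f k).continuous.tendsto x).comp hx) ?_⟩
  refine tendsto_const_nhds.congr' (eventually_atTop.2 ⟨k + 1, fun m hm => ?_⟩)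
  obtain ⟨d, rfl⟩ := Nat.exists_eq_add_of_le hm
  exact (hval k d).symm

theorem exists_isEidelheit_of_not_isNormable [ContinuousSMul ℂ E]
    [LocallyConvexSpace ℝ E] [TopologicalSpace.MetrizableSpace E]
    (hE : ¬ IsNormable E) : ∃ x' : ℕ → StrongDual ℂ E, IsEidelheit (F := fun _ => ℂ) x' := by
  obtain ⟨U, hU⟩ := (𝓝 (0 : E)).exists_antitone_basis
  choose r hr hrU using fun n => exists_continuous_seminorm_ball_subset (hU.mem n)
  choose F hF using fun p : {p : Seminorm ℂ E // Continuous p} =>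
    exists_functional_not_bounded hE p.1 p.2
  -- The term `F p` makes the functional just chosen bounded from now on; `r (n + 1)` makes the
  -- sequence define the topology.
  let P : ℕ → {p : Seminorm ℂ E // Continuous p} :=
    Nat.rec ⟨r 0, hr 0⟩ fun n p =>
      ⟨p.1 + (F p).toSeminorm + r (n + 1), (p.2.add (F p).continuous.norm).add (hr (n + 1))⟩
  have hPs : ∀ n x, (P (n + 1)).1 x = (P n).1 x + ‖F (P n) x‖ + r (n + 1) x := fun _ _ => rfl
  have hmono : Monotone fun n => (P n).1 := monotone_nat_of_le_succ fun n x => by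
    have := apply_nonneg (r (n + 1)) x
    have := norm_nonneg (F (P n) x)
    have := hPs n x
    linarith
  refine ⟨fun n => F (P n), isEidelheit_of_not_bounded (fun n => (P n).1) hmono ?_ _ ?_
    fun n => hF _⟩
  · intro V hV
    obtain ⟨n, -, hn⟩ := hU.1.mem_iff.1 hV
    refine ⟨n, fun x hx => hn (hrU n x (lt_of_le_of_lt ?_ hx))⟩
    cases n with
    | zero => exact le_rfl
    | succ n =>
      have := apply_nonneg (P n).1 x
      have := norm_nonneg (F (P n) x)
      have := hPs n x
      linarith
  · intro n j hj
    refine ⟨1, fun x => ?_⟩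
    have h1 : (P (j + 1)).1 x ≤ (P n).1 x := hmono hj x
    have := apply_nonneg (P j).1 x
    have := apply_nonneg (r (j + 1)) x
    have := hPs j x
    linarith

end Frechet

theorem lemma4p5 (E : Type*) [AddCommGroup E] [Module ℂ E] [UniformSpace E]
    [IsUniformAddGroup E] [ContinuousSMul ℂ E] [LocallyConvexSpace ℝ E]
    [CompleteSpace E] [TopologicalSpace.MetrizableSpace E] :
    ¬ IsNormable E ↔
      ∃ x' : ℕ → StrongDual ℂ E, IsEidelheit (F := fun _ => ℂ) x' :=
  ⟨exists_isEidelheit_of_not_isNormable, fun ⟨x', hx'⟩ hE => hE.not_isEidelheit x' hx'⟩
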